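/- Let $n, r\ge 0$ be integers with $n \ge 3.5r+1$, let $[n]=\{1,2,\dots,n\}$, and let $\mathcal F\subset 2^{[n]}$ be a family of subsets of $[n]$ that is $2r$-union, that is, $|F\cup F'|\le 2r$ for all $F,F'\in\mathcal F$ (where $F=F'$ is allowed). Write $\mathcal F^{(\ge r)}=\{F\in\mathcal F\colon |F|\ge r\}$, and let $\binom{[n]}{r}$ denote the family of all $r$-element subsets of $[n]$. Then $$|\mathcal F^{(\ge r)}|\le\binom nr,$$ with equality if and only if $\mathcal F^{(\ge r)}=\binom{[n]}{r}$. -/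

import Mathlib

/-- A family `F` of subsets of `[n]` (modelled by `Fin n`) is `u`-union if `|A ∪ B| ≤ u` for all
`A, B ∈ F`; the two members need not be distinct, so in particular every member has size at most
`u`. -/
def IsUnionFamily {n : ℕ} (u : ℕ) (F : Finset (Finset (Fin n))) : Prop :=
  ∀ A ∈ F, ∀ B ∈ F, (A ∪ B).card ≤ u

/-- The subfamily `F^{(≥ l)}` of the members of `F` of size at least `l`. -/
def layersGE {n : ℕ} (l : ℕ) (F : Finset (Finset (Fin n))) : Finset (Finset (Fin n)) :=
  F.filter (fun A => l ≤ A.card)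

/-- The full `k`-th layer: all `k`-element subsets of `[n]`. -/
def fullLayer (n k : ℕ) : Finset (Finset (Fin n)) :=
  Finset.powersetCard k Finset.univ

open Finset

/-! Complements turn the family into a `t`-intersecting one with `t = n - 2r`, and the layer `r + j`
into the layer `n - r - j`. Shifting keeps all layer sizes, so this family may be taken
left-shifted. Let `L j` be its layer `n - r - j`, and `E` the union of the `r`-shadows of the `L j`,
`1 ≤ j ≤ r`. No complement of an `(n - r)`-set of the family lies in `E`: such a set would meet a
member of `L j` in only `t - j` points. So these complements and `E` are disjoint in the layer `r`,
and it suffices that the `L j` have fewer than `|E|` members in total, unless all are empty.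
Katona's shadow theorem (`card_mul_choose_le_of_isLeftShifted`) bounds `|L j|` by `|E|` times a
ratio of binomials, which is at most `2^(-j)` when `n ≥ 3.5r + 1` (`two_pow_mul_choose_le`). As `∑
2^(-j) < 1`, the inequality is strict, which also settles equality. -/

/-- Moving `j` to `i` in a member `A` of `H`, unless this is impossible or the result is in `H`. -/
def shiftMember (H : Finset (Finset ℕ)) (i j : ℕ) (A : Finset ℕ) : Finset ℕ :=
  if j ∈ A ∧ i ∉ A ∧ insert i (A.erase j) ∉ H then insert i (A.erase j) else A

/-- Any two members of `G` (possibly equal) have at least `t` common elements. -/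
def IsTIntersecting (t : ℕ) (G : Finset (Finset ℕ)) : Prop :=
  ∀ A ∈ G, ∀ B ∈ G, t ≤ (A ∩ B).card

/-- Replacing an element of a member of `G` by a smaller one gives a member of `G`. -/
def IsLeftShifted (G : Finset (Finset ℕ)) : Prop :=
  ∀ A ∈ G, ∀ i j, i < j → j ∈ A → i ∉ A → insert i (A.erase j) ∈ G

/-- The `l`-element subsets of the members of `G`. -/
def lShadow (l : ℕ) (G : Finset (Finset ℕ)) : Finset (Finset ℕ) :=
  G.biUnion (powersetCard l)

theorem mem_lShadow {l : ℕ} {G : Finset (Finset ℕ)} {B : Finset ℕ} :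
    B ∈ lShadow l G ↔ ∃ A ∈ G, B ⊆ A ∧ B.card = l := by
  simp [lShadow, mem_powersetCard]

/-! ### Shifting preserves `t`-intersection and layer sizes. -/

section Shifting

theorem card_insert_erase {A : Finset ℕ} {i j : ℕ} (hj : j ∈ A) (hi : i ∉ A) :
    (insert i (A.erase j)).card = A.card := by
  rw [card_insert_of_notMem (fun h => hi (mem_of_mem_erase h)), card_erase_add_one hj]

theorem erase_insert_erase {A : Finset ℕ} {i j : ℕ} (hj : j ∈ A) (hi : i ∉ A) :
    insert j ((insert i (A.erase j)).erase i) = A := by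
  rw [erase_insert (fun h => hi (mem_of_mem_erase h)), insert_erase hj]

theorem card_shiftMember (H : Finset (Finset ℕ)) (i j : ℕ) (A : Finset ℕ) :
    (shiftMember H i j A).card = A.card := by
  unfold shiftMember
  split_ifs with h
  · exact card_insert_erase h.1 h.2.1
  · rfl

theorem injOn_shiftMember (H : Finset (Finset ℕ)) (i j : ℕ) :
    Set.InjOn (shiftMember H i j) H := by
  intro A hA B hB hAB
  unfold shiftMember at hAB
  split_ifs at hAB with h1 h2 h2
  · rw [← erase_insert_erase h1.1 h1.2.1, hAB, erase_insert_erase h2.1 h2.2.1]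
  · exact absurd (hAB ▸ hB) h1.2.2
  · exact absurd (hAB ▸ hA) h2.2.2
  · exact hAB

/-- The case where `A` moves and `B` stays. If `B` stays because its shift is already in `H`, that
shift meets `A` exactly where `B` meets the moved `A`; otherwise the move loses no common point
without gaining one. -/
theorem card_inter_shift_of_shifted {t i j : ℕ} {H : Finset (Finset ℕ)}
    (hH : IsTIntersecting t H) {A B : Finset ℕ} (hA : A ∈ H) (hB : B ∈ H)
    (hjA : j ∈ A) (hiA : i ∉ A)
    (hB' : ¬ (j ∈ B ∧ i ∉ B ∧ insert i (B.erase j) ∉ H)) :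
    t ≤ (insert i (A.erase j) ∩ B).card := by
  by_cases hjB : j ∈ B
  · by_cases hiB : i ∈ B
    · have : insert i (A.erase j) ∩ B = insert i ((A ∩ B).erase j) := by grind
      rw [this, card_insert_erase (by grind) (by grind)]
      exact hH A hA B hB
    · have hmem : insert i (B.erase j) ∈ H := by tauto
      have : insert i (A.erase j) ∩ B = A ∩ insert i (B.erase j) := by grind
      rw [this]
      exact hH A hA _ hmem
  · refine (hH A hA B hB).trans (card_le_card ?_)
    grind

theorem IsTIntersecting.image_shiftMember {t : ℕ} {H : Finset (Finset ℕ)}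
    (hH : IsTIntersecting t H) (i j : ℕ) :
    IsTIntersecting t (H.image (shiftMember H i j)) := by
  intro A' hA' B' hB'
  obtain ⟨A, hA, rfl⟩ := mem_image.1 hA'
  obtain ⟨B, hB, rfl⟩ := mem_image.1 hB'
  unfold shiftMember
  split_ifs with h1 h2 h2
  · have : insert i (A.erase j) ∩ insert i (B.erase j) = insert i ((A ∩ B).erase j) := by grind
    rw [this, card_insert_erase (by grind) (by grind)]
    exact hH A hA B hB
  · exact card_inter_shift_of_shifted hH hA hB h1.1 h1.2.1 h2
  · rw [inter_comm]
    exact card_inter_shift_of_shifted hH hB hA h2.1 h2.2.1 h1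
  · exact hH A hA B hB

theorem sum_insert_erase_lt {A : Finset ℕ} {i j : ℕ} (hij : i < j) (hj : j ∈ A) (hi : i ∉ A) :
    ∑ x ∈ insert i (A.erase j), x < ∑ x ∈ A, x := by
  rw [sum_insert (fun h => hi (mem_of_mem_erase h)), ← add_sum_erase A (fun x => x) hj]
  simpa using hij

/-- Every `t`-intersecting family can be shifted, keeping the numbers of members of each size. -/
theorem exists_isLeftShifted (n t : ℕ) (H : Finset (Finset ℕ)) (hsub : ∀ A ∈ H, A ⊆ range n)
    (hH : IsTIntersecting t H) :
    ∃ H' : Finset (Finset ℕ), (∀ A ∈ H', A ⊆ range n) ∧ IsTIntersecting t H' ∧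
      IsLeftShifted H' ∧
      ∀ k, (H'.filter (fun A => A.card = k)).card = (H.filter (fun A => A.card = k)).card := by
  -- Each effective shift lowers the total of all elements of all members, so the process ends.
  induction hw : ∑ A ∈ H, ∑ x ∈ A, x using Nat.strong_induction_on generalizing H with
  | _ w ih =>
    by_cases hs : IsLeftShifted H
    · exact ⟨H, hsub, hH, hs, fun _ => rfl⟩
    · unfold IsLeftShifted at hs
      push Not at hs
      obtain ⟨A, hA, i, j, hij, hj, hi, hnot⟩ := hs
      have hinj := injOn_shiftMember H i j
      have hle : ∀ B ∈ H, ∑ x ∈ shiftMember H i j B, x ≤ ∑ x ∈ B, x := by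
        intro B _
        unfold shiftMember
        split_ifs with h
        · exact (sum_insert_erase_lt hij h.1 h.2.1).le
        · exact le_rfl
      have hlt : ∑ B ∈ H.image (shiftMember H i j), ∑ x ∈ B, x < w := by
        rw [sum_image hinj, ← hw]
        refine sum_lt_sum hle ⟨A, hA, ?_⟩
        rw [shiftMember, if_pos ⟨hj, hi, hnot⟩]
        exact sum_insert_erase_lt hij hj hi
      obtain ⟨H', h1, h2, h3, h4⟩ := ih _ hlt (H.image (shiftMember H i j)) (by
        intro B' hB'
        obtain ⟨B, hB, rfl⟩ := mem_image.1 hB'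
        have hBn := hsub B hB
        unfold shiftMember
        split_ifs with h
        · have hjn := mem_range.1 (hBn h.1)
          exact insert_subset (mem_range.2 (hij.trans hjn)) ((erase_subset _ _).trans hBn)
        · exact hBn) (hH.image_shiftMember i j) rfl
      refine ⟨H', h1, h2, h3, fun k => (h4 k).trans ?_⟩
      rw [card_filter, card_filter, sum_image hinj]
      simp only [card_shiftMember]

end Shifting

/-! ### The binomial estimate behind `n ≥ 3.5r + 1`. -/

section Binomials

theorem choose_add_two_mul_left (M s : ℕ) :
    (M + 2).choose (s + 1) * ((s + 1) * (M + 1 - s)) = (M + 2) * (M + 1) * M.choose s := by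
  have h1 := Nat.add_one_mul_choose_eq (M + 1) s
  have h2 := Nat.choose_mul_succ_eq M s
  calc _ = ((M + 2).choose (s + 1) * (s + 1)) * (M + 1 - s) := by ring
    _ = (M + 2) * ((M + 1).choose s * (M + 1 - s)) := by rw [← h1]; ring
    _ = _ := by rw [← h2]; ring

theorem choose_add_two_mul_right (M r : ℕ) :
    (M + 2).choose r * ((M + 2 - r) * (M + 1 - r)) = (M + 2) * (M + 1) * M.choose r := by
  have h1 := Nat.choose_mul_succ_eq (M + 1) r
  have h2 := Nat.choose_mul_succ_eq M r
  calc _ = ((M + 2).choose r * (M + 1 + 1 - r)) * (M + 1 - r) := by ring_nf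
    _ = (M + 2) * ((M + 1).choose r * (M + 1 - r)) := by rw [← h1]; ring
    _ = _ := by rw [← h2]; ring

theorem two_pow_mul_choose_le {n r : ℕ} (hn : 7 * r + 2 ≤ 2 * n) {j : ℕ} (hj : j ≤ r) :
    2 ^ j * (n - 2 * j).choose (r - j) ≤ (n - 2 * j).choose r := by
  induction j with
  | zero => simp
  | succ j ih =>
    have ih := ih (by omega)
    obtain ⟨s, rfl⟩ : ∃ s, r = s + 1 + j := ⟨r - j - 1, by omega⟩
    obtain ⟨M, rfl⟩ : ∃ M, n = M + 2 + 2 * j := ⟨n - 2 - 2 * j, by omega⟩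
    rw [show M + 2 + 2 * j - 2 * j = M + 2 by omega, show s + 1 + j - j = s + 1 by omega] at ih
    rw [show M + 2 + 2 * j - 2 * (j + 1) = M by omega, show s + 1 + j - (j + 1) = s by omega]
    have hR := choose_add_two_mul_right M (s + 1 + j)
    have hL := choose_add_two_mul_left M s
    obtain ⟨x, rfl⟩ : ∃ x, M = x + s + j := ⟨M - s - j, by omega⟩
    rw [show x + s + j + 2 - (s + 1 + j) = x + 1 by omega,
      show x + s + j + 1 - (s + 1 + j) = x by omega] at hR
    rw [show x + s + j + 1 - s = x + 1 + j by omega] at hL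
    -- One step in `j` multiplies the quotient of the two binomials by `(s+1)(x+1+j) / ((x+1)x)`,
    -- which must be at most `1/2`. At `2x = 5a + j` with `a = s + 1`, four times the slack is
    -- `(a-j)² + 4a² + 2a + 2j`.
    have key : 2 * ((s + 1) * (x + 1 + j)) ≤ (x + 1) * x := by
      have hx : 5 * (s + 1) + j ≤ 2 * x := by omega
      zify at hx ⊢
      nlinarith [sq_nonneg ((s : ℤ) + 1 - j), mul_nonneg (sub_nonneg.2 hx) (sub_nonneg.2 hx),
        mul_nonneg (sub_nonneg.2 hx) (Int.natCast_nonneg s),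
        mul_nonneg (sub_nonneg.2 hx) (Int.natCast_nonneg j), Int.natCast_nonneg s,
        Int.natCast_nonneg j, sq_nonneg (s : ℤ), sq_nonneg (j : ℤ)]
    refine Nat.le_of_mul_le_mul_left ?_
      (show 0 < (x + s + j + 2) * (x + s + j + 1) by positivity)
    calc (x + s + j + 2) * (x + s + j + 1) * (2 ^ (j + 1) * (x + s + j).choose s)
        = 2 ^ j * (x + s + j + 2).choose (s + 1) * (2 * ((s + 1) * (x + 1 + j))) := by
          rw [pow_succ]
          linear_combination (2 ^ j * 2) * hL.symm
      _ ≤ (x + s + j + 2).choose (s + 1 + j) * ((x + 1) * x) := Nat.mul_le_mul ih key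
      _ = _ := hR

end Binomials

/-! ### Katona's intersecting shadow theorem. -/

section Shadow

/-- The iterated local LYM inequality, by double counting. -/
theorem card_mul_choose_le_card_lShadow {n k l : ℕ} {G : Finset (Finset ℕ)}
    (hsub : ∀ A ∈ G, A ⊆ range n) (hk : ∀ A ∈ G, A.card = k) :
    G.card * k.choose l ≤ (lShadow l G).card * (n - l).choose (k - l) := by
  refine card_mul_le_card_mul (fun A B => B ⊆ A) (fun A hA => ?_) (fun B hB => ?_)
  · rw [← hk A hA, ← card_powersetCard]
    refine card_le_card fun B hB => ?_
    rw [mem_powersetCard] at hB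
    exact mem_filter.2 ⟨mem_lShadow.2 ⟨A, hA, hB⟩, hB.1⟩
  · obtain ⟨A₀, hA₀, hBA₀, hBl⟩ := mem_lShadow.1 hB
    have hc : (range n \ B).card = n - l := by
      rw [card_sdiff_of_subset (hBA₀.trans (hsub A₀ hA₀)), card_range, hBl]
    rw [← hc, ← card_powersetCard]
    refine card_le_card_of_injOn (fun A => A \ B) (fun A hA => ?_) (fun A hA A' hA' h => ?_)
    · obtain ⟨hAG, hBA⟩ := mem_filter.1 hA
      refine mem_powersetCard.2 ⟨sdiff_subset_sdiff (hsub A hAG) le_rfl, ?_⟩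
      rw [card_sdiff_of_subset hBA, hk A hAG, hBl]
    · have h1 := (mem_filter.1 hA).2
      have h2 := (mem_filter.1 hA').2
      rw [← sdiff_union_of_subset h1, ← sdiff_union_of_subset h2]
      exact congrArg (· ∪ B) h

/-- Shadow sets avoiding `m` come from the members without `m`; those containing `m` come from the
link of `m`, with `m` put back. -/
theorem card_lShadow_split_le (m l : ℕ) (G : Finset (Finset ℕ)) :
    (lShadow (l + 1) (G.filter (fun A => m ∉ A))).card +
      (lShadow l ((G.filter (fun A => m ∈ A)).image (fun A => A.erase m))).card ≤
      (lShadow (l + 1) G).card := by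
  set G₁ := (G.filter (fun A => m ∈ A)).image (fun A => A.erase m)
  have hm : ∀ B ∈ lShadow l G₁, m ∉ B := by
    intro B hB hmB
    obtain ⟨A, hA, hBA, -⟩ := mem_lShadow.1 hB
    obtain ⟨A', -, rfl⟩ := mem_image.1 hA
    exact notMem_erase m A' (hBA hmB)
  have hinj : Set.InjOn (insert m) (lShadow l G₁ : Set (Finset ℕ)) := by
    intro B hB B' hB' h
    rw [← erase_insert (hm B hB), h, erase_insert (hm B' hB')]
  rw [← card_image_of_injOn hinj, ← card_union_of_disjoint]
  · refine card_le_card (union_subset (fun B hB => ?_) fun B hB => ?_)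
    · obtain ⟨A, hA, h⟩ := mem_lShadow.1 hB
      exact mem_lShadow.2 ⟨A, (mem_filter.1 hA).1, h⟩
    · obtain ⟨C, hC, rfl⟩ := mem_image.1 hB
      have hmC := hm C hC
      obtain ⟨A, hA, hCA, hCl⟩ := mem_lShadow.1 hC
      obtain ⟨A', hA', rfl⟩ := mem_image.1 hA
      obtain ⟨hA'G, hmA'⟩ := mem_filter.1 hA'
      exact mem_lShadow.2 ⟨A', hA'G, insert_subset hmA' (hCA.trans (erase_subset _ _)),
        by rw [card_insert_of_notMem hmC, hCl]⟩
  · rw [disjoint_left]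
    intro B hB hB'
    obtain ⟨A, hA, hBA, -⟩ := mem_lShadow.1 hB
    obtain ⟨C, -, rfl⟩ := mem_image.1 hB'
    exact (mem_filter.1 hA).2 (hBA (mem_insert_self m C))

/-- In a large ground set, the link of the last element of a shifted `t`-intersecting family is
still `t`-intersecting. -/
theorem IsTIntersecting.link {m t s : ℕ} {G : Finset (Finset ℕ)}
    (hk : ∀ A ∈ G, A.card = t + s) (hG : IsTIntersecting t G)
    (hs : IsLeftShifted G) (hm : t + 2 * s < m + 1) :
    IsTIntersecting t ((G.filter (fun A => m ∈ A)).image (fun A => A.erase m)) := by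
  intro A' hA' B' hB'
  obtain ⟨A, hA, rfl⟩ := mem_image.1 hA'
  obtain ⟨B, hB, rfl⟩ := mem_image.1 hB'
  obtain ⟨hAG, hmA⟩ := mem_filter.1 hA
  obtain ⟨hBG, hmB⟩ := mem_filter.1 hB
  have hinter : A.erase m ∩ B.erase m = (A ∩ B).erase m := by grind
  have hcard := card_erase_add_one (mem_inter.2 ⟨hmA, hmB⟩)
  rw [hinter]
  by_contra! hlt
  have hu := card_union_add_card_inter A B
  rw [hk A hAG, hk B hBG] at hu
  have hge := hG A hAG B hBG
  -- Here `A` and `B` share exactly `t` points, so their union has `t + 2s < m + 1` points and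
  -- misses some `i`. Moving `m` to `i` in `A` then leaves only `t - 1` points in common with `B`.
  obtain ⟨i, hi, hiAB⟩ : ∃ i ∈ range (m + 1), i ∉ A ∪ B := by
    by_contra! h
    have := card_le_card (show range (m + 1) ⊆ A ∪ B from h)
    rw [card_range] at this
    omega
  rw [mem_union, not_or] at hiAB
  have him : i < m := lt_of_le_of_ne (by simpa [Nat.lt_succ_iff] using hi)
    (fun h => hiAB.1 (h ▸ hmA))
  have h := hG _ (hs A hAG i m him hmA hiAB.1) B hBG
  have : insert i (A.erase m) ∩ B = (A ∩ B).erase m := by grind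
  rw [this] at h
  omega

/-- Transfers the bound for the link to the parameters of the whole family. With `l = s + a` and `t
= a + b`, it rests on `(s+1)(s+a+b+1) ≤ (s+a+1)(s+b+1)`, whose slack is `ab`. -/
theorem choose_mul_le_of_choose_mul_le {t s l g c : ℕ} (hl : s ≤ l) (hlt : l ≤ t + s)
    (h : g * (t + 2 * s).choose l ≤ c * (t + 2 * s).choose s) :
    g * (t + 2 * (s + 1)).choose (l + 1) ≤ c * (t + 2 * (s + 1)).choose (s + 1) := by
  have h1 := choose_add_two_mul_left (t + 2 * s) l
  have h2 := choose_add_two_mul_left (t + 2 * s) s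
  rw [show t + 2 * (s + 1) = t + 2 * s + 2 by ring]
  obtain ⟨a, rfl⟩ := Nat.exists_eq_add_of_le hl
  obtain ⟨b, rfl⟩ := Nat.exists_eq_add_of_le (show a ≤ t by omega)
  rw [show a + b + 2 * s + 1 - (s + a) = s + b + 1 by omega] at h1
  rw [show a + b + 2 * s + 1 - s = s + a + b + 1 by omega] at h2
  refine Nat.le_of_mul_le_mul_right ?_ (show 0 < (s + a + 1) * (s + b + 1) by positivity)
  calc _ = g * ((a + b + 2 * s + 2).choose (s + a + 1) * ((s + a + 1) * (s + b + 1))) := by ring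
    _ = (a + b + 2 * s + 2) * (a + b + 2 * s + 1) * (g * (a + b + 2 * s).choose (s + a)) := by
      rw [h1]; ring
    _ ≤ (a + b + 2 * s + 2) * (a + b + 2 * s + 1) * (c * (a + b + 2 * s).choose s) :=
      Nat.mul_le_mul_left _ h
    _ = c * ((a + b + 2 * s + 2).choose (s + 1) * ((s + 1) * (s + a + b + 1))) := by
      rw [h2]; ring
    _ ≤ c * ((a + b + 2 * s + 2).choose (s + 1) * ((s + a + 1) * (s + b + 1))) := by
      refine Nat.mul_le_mul_left _ (Nat.mul_le_mul_left _ ?_)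
      nlinarith [Nat.zero_le (a * b)]
    _ = _ := by ring

/-- On a ground set of at most `t + 2s` points local LYM alone suffices: at `n = t + 2s` it gives
exactly this ratio. -/
theorem card_mul_choose_le_of_le {n t s l : ℕ} {G : Finset (Finset ℕ)}
    (hsub : ∀ A ∈ G, A ⊆ range n) (hk : ∀ A ∈ G, A.card = t + s) (hlt : l ≤ t + s)
    (hn : n ≤ t + 2 * s) :
    G.card * (t + 2 * s).choose l ≤ (lShadow l G).card * (t + 2 * s).choose s := by
  have h1 := card_mul_choose_le_card_lShadow (l := l) hsub hk
  have h2 : (n - l).choose (t + s - l) ≤ (t + 2 * s - l).choose (t + s - l) :=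
    Nat.choose_le_choose _ (by omega)
  have h3 := Nat.choose_mul (n := t + 2 * s) hlt
  have h4 : (t + 2 * s).choose (t + s) = (t + 2 * s).choose s :=
    Nat.choose_symm_of_eq_add (by ring)
  refine Nat.le_of_mul_le_mul_right ?_ (Nat.choose_pos hlt)
  calc _ = (G.card * (t + s).choose l) * (t + 2 * s).choose l := by ring
    _ ≤ ((lShadow l G).card * (t + 2 * s - l).choose (t + s - l)) * (t + 2 * s).choose l :=
      Nat.mul_le_mul_right _ (h1.trans (Nat.mul_le_mul_left _ h2))
    _ = (lShadow l G).card * ((t + 2 * s).choose (t + s) * (t + s).choose l) := by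
      rw [h3]; ring
    _ = _ := by rw [h4]; ring

/-- Katona's intersecting shadow theorem, for shifted families. -/
theorem card_mul_choose_le_of_isLeftShifted {n t s l : ℕ} {G : Finset (Finset ℕ)}
    (hsub : ∀ A ∈ G, A ⊆ range n) (hk : ∀ A ∈ G, A.card = t + s) (hG : IsTIntersecting t G)
    (hs : IsLeftShifted G) (hl : s ≤ l) (hlt : l ≤ t + s) :
    G.card * (t + 2 * s).choose l ≤ (lShadow l G).card * (t + 2 * s).choose s := by
  induction n generalizing s l G with
  | zero => exact card_mul_choose_le_of_le hsub hk hlt (Nat.zero_le _)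
  | succ m ih =>
    rcases le_or_gt (m + 1) (t + 2 * s) with hm | hm
    · exact card_mul_choose_le_of_le hsub hk hlt hm
    set G₀ := G.filter (fun A => m ∉ A) with hG₀
    set G₁ := (G.filter (fun A => m ∈ A)).image (fun A => A.erase m) with hG₁
    have hlink : IsTIntersecting t G₁ := hG.link hk hs hm
    have hrange : ∀ A ∈ G, A.erase m ⊆ range m := by
      intro A hA x hx
      have := mem_range.1 (hsub A hA (mem_of_mem_erase hx))
      have := ne_of_mem_erase hx
      exact mem_range.2 (by omega)
    have hk₁ : ∀ A ∈ G₁, A.card + 1 = t + s := by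
      intro A' hA'
      obtain ⟨A, hA, rfl⟩ := mem_image.1 hA'
      obtain ⟨hAG, hmA⟩ := mem_filter.1 hA
      rw [card_erase_add_one hmA, hk A hAG]
    have hcard : G.card = G₀.card + G₁.card := by
      rw [hG₁, card_image_of_injOn, ← card_filter_add_card_filter_not (s := G) (fun A => m ∈ A),
        add_comm]
      intro A hA B hB h
      rw [← insert_erase (mem_filter.1 hA).2, ← insert_erase (mem_filter.1 hB).2]
      exact congrArg (insert m) h
    have h₀ : G₀.card * (t + 2 * s).choose l ≤ (lShadow l G₀).card * (t + 2 * s).choose s := by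
      refine ih (fun A hA => ?_) (fun A hA => hk A (mem_filter.1 hA).1)
        (fun A hA B hB => hG A (mem_filter.1 hA).1 B (mem_filter.1 hB).1) ?_ hl hlt
      · obtain ⟨hAG, hmA⟩ := mem_filter.1 hA
        rw [← erase_eq_of_notMem hmA]
        exact hrange A hAG
      · intro A hA i j hij hj hi
        obtain ⟨hAG, hmA⟩ := mem_filter.1 hA
        have hjm := mem_range.1 (hsub A hAG hj)
        refine mem_filter.2 ⟨hs A hAG i j hij hj hi, fun hmem => ?_⟩
        rcases mem_insert.1 hmem with h | h
        · omega
        · exact hmA (mem_of_mem_erase h)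
    cases s with
    | zero =>
      -- Sets in the link have `t - 1` elements, yet each must meet itself in `t`.
      have hempty : G₁ = ∅ := by
        refine eq_empty_of_forall_notMem fun A hA => ?_
        have h1 := hlink A hA A hA
        have h2 := hk₁ A hA
        rw [inter_self] at h1
        omega
      rw [hcard, hempty, card_empty, add_zero]
      refine h₀.trans (Nat.mul_le_mul_right _ (card_le_card ?_))
      exact biUnion_subset_biUnion_of_subset_left _ (filter_subset _ _)
    | succ s =>
      obtain ⟨l, rfl⟩ : ∃ l', l = l' + 1 := ⟨l - 1, by omega⟩
      have h₁ : G₁.card * (t + 2 * s).choose l ≤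
          (lShadow l G₁).card * (t + 2 * s).choose s := by
        refine ih (fun A' hA' => ?_) (fun A hA => ?_) hlink ?_ (by omega) (by omega)
        · obtain ⟨A, hA, rfl⟩ := mem_image.1 hA'
          exact hrange A (mem_filter.1 hA).1
        · have := hk₁ A hA
          omega
        · intro A' hA' i j hij hj hi
          obtain ⟨A, hA, rfl⟩ := mem_image.1 hA'
          obtain ⟨hAG, hmA⟩ := mem_filter.1 hA
          have hjA := mem_of_mem_erase hj
          have hjm := mem_range.1 (hrange A hAG hj)
          have hiA : i ∉ A := fun h => hi (mem_erase.2 ⟨by omega, h⟩)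
          refine mem_image.2 ⟨insert i (A.erase j), mem_filter.2
            ⟨hs A hAG i j hij hjA hiA, ?_⟩, ?_⟩
          · exact mem_insert_of_mem (mem_erase.2 ⟨by omega, hmA⟩)
          · rw [erase_insert_of_ne (by omega), erase_right_comm]
      have h₁' := choose_mul_le_of_choose_mul_le (by omega) (by omega) h₁
      calc _ = G₀.card * (t + 2 * (s + 1)).choose (l + 1) +
            G₁.card * (t + 2 * (s + 1)).choose (l + 1) := by rw [hcard]; ring
        _ ≤ ((lShadow (l + 1) G₀).card + (lShadow l G₁).card) *
            (t + 2 * (s + 1)).choose (s + 1) := by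
          rw [add_mul]
          exact Nat.add_le_add h₀ h₁'
        _ ≤ _ := Nat.mul_le_mul_right _ (card_lShadow_split_le m l G)

end Shadow

/-! ### Comparing layers through complements. -/

section LayerCount

theorem sum_lt_of_two_pow_mul_le {r e : ℕ} {g : ℕ → ℕ}
    (h : ∀ j ∈ Icc 1 r, 2 ^ j * g j ≤ e) (hpos : 0 < ∑ j ∈ Icc 1 r, g j) :
    ∑ j ∈ Icc 1 r, g j < e := by
  -- The bound `∑ g j ≤ (1 - 2^(-m)) e`, cleared of denominators.
  have key : ∀ m ≤ r, 2 ^ m * ∑ j ∈ Icc 1 m, g j + e ≤ 2 ^ m * e := by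
    intro m
    induction m with
    | zero => simp
    | succ m ih =>
      intro hm
      have h1 := ih (by omega)
      have h2 := h (m + 1) (mem_Icc.2 ⟨by omega, hm⟩)
      rw [sum_Icc_succ_top (by omega), mul_add, pow_succ] at *
      linarith
  obtain ⟨j, hj, hgj⟩ : ∃ j ∈ Icc 1 r, 0 < g j := by
    by_contra! hcon
    have := sum_eq_zero (fun j hj => Nat.le_zero.1 (hcon j hj))
    omega
  have he : 0 < e := lt_of_lt_of_le (by positivity) (h j hj)
  have := key r le_rfl
  refine lt_of_mul_lt_mul_left (a := 2 ^ r) ?_ (Nat.zero_le _)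
  omega

/-- The upper bound for the complements of a union family: the small layers of an
`(n - 2r)`-intersecting family compared with the layer `n - r`. -/
theorem card_layer_add_sum_lt {n r : ℕ} (hn : 7 * r + 2 ≤ 2 * n) {H : Finset (Finset ℕ)}
    (hsub : ∀ A ∈ H, A ⊆ range n) (hH : IsTIntersecting (n - 2 * r) H)
    (hpos : 0 < ∑ j ∈ Icc 1 r, (H.filter (fun A => A.card = n - r - j)).card) :
    (H.filter (fun A => A.card = n - r)).card +
      ∑ j ∈ Icc 1 r, (H.filter (fun A => A.card = n - r - j)).card < n.choose r := by
  obtain ⟨K, hKsub, hK, hKs, hKcard⟩ := exists_isLeftShifted n _ H hsub hH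
  simp only [← hKcard] at hpos ⊢
  set L : ℕ → Finset (Finset ℕ) := fun j => K.filter (fun A => A.card = n - r - j) with hL
  set E := (Icc 1 r).biUnion (fun j => lShadow r (L j)) with hE
  set T := (K.filter (fun A => A.card = n - r)).image (fun A => range n \ A) with hT
  have hTcard : T.card = (K.filter (fun A => A.card = n - r)).card := by
    refine card_image_of_injOn fun A hA B hB h => ?_
    rw [← Finset.sdiff_sdiff_eq_self (hKsub A (mem_filter.1 hA).1),
      ← Finset.sdiff_sdiff_eq_self (hKsub B (mem_filter.1 hB).1)]
    exact congrArg (range n \ ·) h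
  have hbound : ∀ j ∈ Icc 1 r, 2 ^ j * (L j).card ≤ E.card := by
    intro j hj
    obtain ⟨hj1, hjr⟩ := mem_Icc.1 hj
    -- Members of `L j` have `n - r - j = t + (r - j)` elements, hence `s = r - j` and `t + 2s = n -
    -- 2j`.
    have hshadow := card_mul_choose_le_of_isLeftShifted (n := n) (t := n - 2 * r) (s := r - j)
      (l := r) (G := L j) (fun A hA => hKsub A (mem_filter.1 hA).1)
      (fun A hA => by rw [(mem_filter.1 hA).2]; omega)
      (fun A hA B hB => hK A (mem_filter.1 hA).1 B (mem_filter.1 hB).1)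
      (fun A hA a b hab hb ha => by
        obtain ⟨hAK, hAc⟩ := mem_filter.1 hA
        exact mem_filter.2 ⟨hKs A hAK a b hab hb ha, by rw [card_insert_erase hb ha, hAc]⟩)
      (by omega) (by omega)
    rw [show n - 2 * r + 2 * (r - j) = n - 2 * j by omega] at hshadow
    have hchoose := two_pow_mul_choose_le hn hjr
    have hc : 0 < (n - 2 * j).choose (r - j) := Nat.choose_pos (by omega)
    refine le_trans ?_ (card_le_card (subset_biUnion_of_mem (fun j => lShadow r (L j)) hj))
    refine Nat.le_of_mul_le_mul_right ?_ hc
    calc _ = (L j).card * (2 ^ j * (n - 2 * j).choose (r - j)) := by ring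
      _ ≤ (L j).card * (n - 2 * j).choose r := Nat.mul_le_mul_left _ hchoose
      _ ≤ _ := hshadow
  have hlt := sum_lt_of_two_pow_mul_le hbound hpos
  have hdisj : Disjoint T E := by
    rw [disjoint_left]
    intro B hBT hBE
    obtain ⟨X, hX, rfl⟩ := mem_image.1 hBT
    obtain ⟨hXK, -⟩ := mem_filter.1 hX
    obtain ⟨j, hj, hB⟩ := mem_biUnion.1 hBE
    obtain ⟨hj1, hjr⟩ := mem_Icc.1 hj
    obtain ⟨Y, hY, hsubY, hBc⟩ := mem_lShadow.1 hB
    obtain ⟨hYK, hYc⟩ := mem_filter.1 hY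
    have h1 := hK Y hYK X hXK
    have h2 : Y ∩ X = Y \ (range n \ X) := by
      have := hKsub Y hYK
      grind
    rw [h2, card_sdiff_of_subset hsubY, hBc, hYc] at h1
    omega
  have hunion : (T ∪ E).card ≤ n.choose r := by
    have hsubset : T ∪ E ⊆ powersetCard r (range n) := by
      refine union_subset (fun B hB => ?_) fun B hB => ?_
      · obtain ⟨X, hX, rfl⟩ := mem_image.1 hB
        obtain ⟨hXK, hXc⟩ := mem_filter.1 hX
        refine mem_powersetCard.2 ⟨sdiff_subset, ?_⟩
        rw [card_sdiff_of_subset (hKsub X hXK), card_range, hXc]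
        omega
      · obtain ⟨j, -, hB⟩ := mem_biUnion.1 hB
        obtain ⟨Y, hY, hBY, hBc⟩ := mem_lShadow.1 hB
        exact mem_powersetCard.2 ⟨hBY.trans (hKsub Y (mem_filter.1 hY).1), hBc⟩
    simpa using card_le_card hsubset
  rw [card_union_of_disjoint hdisj, hTcard] at hunion
  exact (Nat.add_lt_add_left hlt _).trans_le hunion

/-- The complements of the members of `F`, as sets of natural numbers. -/
def complFamily {n : ℕ} (F : Finset (Finset (Fin n))) : Finset (Finset ℕ) :=
  F.image (fun A => Aᶜ.map Fin.valEmbedding)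

theorem card_filter_complFamily {n : ℕ} (F : Finset (Finset (Fin n))) {k : ℕ} (hk : k ≤ n) :
    ((complFamily F).filter (fun A => A.card = n - k)).card =
      (F.filter (fun A => A.card = k)).card := by
  have hinj : Function.Injective (fun A : Finset (Fin n) => Aᶜ.map Fin.valEmbedding) :=
    (map_injective _).comp compl_injective
  rw [complFamily, filter_image, card_image_of_injective _ hinj]
  congr 1
  refine filter_congr fun A _ => ?_
  have := card_le_univ A
  rw [Fintype.card_fin] at this
  rw [card_map, card_compl, Fintype.card_fin]
  omega

theorem IsUnionFamily.isTIntersecting_complFamily {n u : ℕ} {F : Finset (Finset (Fin n))}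
    (hF : IsUnionFamily u F) : IsTIntersecting (n - u) (complFamily F) := by
  intro A' hA' B' hB'
  obtain ⟨A, hA, rfl⟩ := mem_image.1 hA'
  obtain ⟨B, hB, rfl⟩ := mem_image.1 hB'
  rw [← map_inter, card_map, ← compl_union, card_compl, Fintype.card_fin]
  have := hF A hA B hB
  omega

theorem card_layersGE_eq {n r : ℕ} {F : Finset (Finset (Fin n))}
    (hF : IsUnionFamily (2 * r) F) :
    (layersGE r F).card = (F.filter (fun A => A.card = r)).card +
      ∑ j ∈ Icc 1 r, (F.filter (fun A => A.card = r + j)).card := by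
  have hmaps : ∀ A ∈ layersGE r F, A.card - r ∈ range (r + 1) := by
    intro A hA
    have := hF A (mem_filter.1 hA).1 A (mem_filter.1 hA).1
    rw [union_self] at this
    exact mem_range.2 (by omega)
  have hfib : ∀ j, ((layersGE r F).filter (fun A => A.card - r = j)) =
      F.filter (fun A => A.card = r + j) := by
    intro j
    rw [layersGE, filter_filter]
    exact filter_congr fun A _ => by omega
  rw [card_eq_sum_card_fiberwise hmaps]
  simp only [hfib]
  rw [range_eq_Ico, sum_eq_sum_Ico_succ_bot (by omega)]
  rfl

end LayerCount

/-! ### The main theorem. -/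

theorem theorem1p9 (n r : ℕ) (hn : (3.5 : ℝ) * (r : ℝ) + 1 ≤ (n : ℝ))
    (F : Finset (Finset (Fin n))) (hF : IsUnionFamily (2 * r) F) :
    (layersGE r F).card ≤ n.choose r ∧
      ((layersGE r F).card = n.choose r ↔ layersGE r F = fullLayer n r) := by
  have hn' : 7 * r + 2 ≤ 2 * n := by
    have : (7 * r + 2 : ℝ) ≤ 2 * n := by linarith
    exact_mod_cast this
  have hfull : (fullLayer n r).card = n.choose r := by simp [fullLayer]
  have hsplit := card_layersGE_eq hF
  -- With nothing above layer `r`, the claim is containment in that layer; otherwise the bound is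
  -- strict and both sides of the equivalence fail.
  rcases Nat.eq_zero_or_pos (∑ j ∈ Icc 1 r, (F.filter (fun A => A.card = r + j)).card)
    with h0 | hpos
  · have hsub : layersGE r F ⊆ fullLayer n r := by
      have heq : F.filter (fun A => A.card = r) = layersGE r F :=
        eq_of_subset_of_card_le (fun A hA => mem_filter.2
          ⟨(mem_filter.1 hA).1, (mem_filter.1 hA).2.ge⟩) (by omega)
      rw [← heq]
      exact fun A hA => mem_powersetCard.2 ⟨subset_univ _, (mem_filter.1 hA).2⟩
    rw [← hfull]
    exact ⟨card_le_card hsub, fun h => eq_of_subset_of_card_le hsub h.ge, fun h => h ▸ rfl⟩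
  · have hlayers : ∑ j ∈ Icc 1 r,
        ((complFamily F).filter (fun A => A.card = n - r - j)).card =
        ∑ j ∈ Icc 1 r, (F.filter (fun A => A.card = r + j)).card := by
      refine sum_congr rfl fun j hj => ?_
      have := (mem_Icc.1 hj).2
      rw [Nat.sub_sub, card_filter_complFamily F (by omega)]
    have hlt := card_layer_add_sum_lt hn' (H := complFamily F) (fun A' hA' => by
      obtain ⟨A, -, rfl⟩ := mem_image.1 hA'
      intro x hx
      obtain ⟨y, -, rfl⟩ := mem_map.1 hx
      exact mem_range.2 y.isLt) hF.isTIntersecting_complFamily (by rwa [hlayers])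
    rw [hlayers, card_filter_complFamily F (by omega), ← hsplit] at hlt
    exact ⟨hlt.le, fun h => absurd h hlt.ne, fun h => by rw [h, hfull]⟩
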